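/- Let $d\ge 1$ and $N\ge 1$ be integers. A circuit with $N$ queries on $\mathbb{C}^d$ consists of a finite-dimensional auxiliary space $\mathcal{H}_A$, a density matrix $\rho_A$ on $\mathcal{H}_A$, unitary operators $V_1,\dots,V_{N+1}$ on $\mathbb{C}^d\otimes\mathcal{H}_A$, and an orthogonal projection $P$ on $\mathcal{H}_A$ (the success outcome of a final measurement of the auxiliary system). For $U\in\mathrm{SU}(d)$ put $Z(U)=V_{N+1}(U\otimes I)V_N(U\otimes I)\cdots(U\otimes I)V_1$. On the black box $U$, the circuit implements an operator $W$ exactly with probability $q$ if, for every unit vector $\psi\in\mathbb{C}^d$, $$\operatorname{Tr}_{\mathcal{H}_A}\big[(I\otimes P)\,Z(U)\,(|\psi\rangle\langle\psi|\otimes\rho_A)\,Z(U)^\dagger\,(I\otimes P)\big]=q\,W|\psi\rangle\langle\psi|W^\dagger ,$$ i.e. success occurs with probability $q$ and, given success, the output is $W\psi$ up to a global phase. **Theorem.** Let $U_0\in\mathrm{SU}(d)$, let $p:\mathrm{SU}(d)\to\mathbb{R}$ be differentiable at $U_0$, and suppose that a circuit with $N$ queries implements, for all $U$ in a neighborhood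 of $U_0$ in $\mathrm{SU}(d)$, the transpose $U^T$ exactly with probability $p(U)$ on the black box $U$. Then $$p(U_0)\le\left(\frac{d}{\frac{d^2-1}{N}+1}\right)^2 .$$ In particular, for $N=1$, $p(U_0)\le 1/d^2$; this is tight: there is a circuit with one query that implements $U^T$ exactly with probability $1/d^2$ for every $U\in\mathrm{SU}(d)$. -/

import Mathlib

open scoped Kronecker Topology ComplexOrder

noncomputable section

/-- The special unitary group `SU(d)`. -/
abbrev SUGroup (d : ℕ) : Type := Matrix.specialUnitaryGroup (Fin d) ℂ

/-- Partial trace over the second tensor factor. -/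
def partialTraceAux {d : ℕ} {A : Type*} [Fintype A]
    (M : Matrix (Fin d × A) (Fin d × A) ℂ) : Matrix (Fin d) (Fin d) ℂ :=
  Matrix.of fun i j => ∑ a, M (i, a) (j, a)

/-- The rank-one operator `|ψ⟩⟨ψ|`. -/
def ketbra {n : Type*} (ψ : n → ℂ) : Matrix n n ℂ := Matrix.vecMulVec ψ (star ψ)

/-- `interleave U V = V_N (U ⊗ I) V_{N-1} (U ⊗ I) ⋯ (U ⊗ I) V_0`: the operators `V_0, …, V_N`
with the `N` queries to `U` (on the main system) placed between them. -/
def interleave {d : ℕ} {A : Type*} [Fintype A] [DecidableEq A] (U : Matrix (Fin d) (Fin d) ℂ) :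
    {N : ℕ} → (Fin (N + 1) → Matrix (Fin d × A) (Fin d × A) ℂ) →
      Matrix (Fin d × A) (Fin d × A) ℂ
  | 0, V => V 0
  | n + 1, V =>
      V (Fin.last (n + 1)) * (U ⊗ₖ (1 : Matrix A A ℂ)) *
        interleave U (fun j : Fin (n + 1) => V j.castSucc)

/-- A fixed-order quantum circuit with `N` queries to a `d`-dimensional black box and a flagged
success event: the main system is `ℂ^d`, the auxiliary system is `ℂ^A`. -/
structure QueryCircuit (d N : ℕ) (A : Type*) [Fintype A] [DecidableEq A] where
  /-- the initial state of the auxiliary system, a density matrix -/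
  auxState : Matrix A A ℂ
  auxState_posSemidef : auxState.PosSemidef
  auxState_trace : auxState.trace = 1
  /-- the unitary operations before, between and after the queries -/
  gate : Fin (N + 1) → Matrix (Fin d × A) (Fin d × A) ℂ
  gate_unitary : ∀ j, gate j ∈ Matrix.unitaryGroup (Fin d × A) ℂ
  /-- the orthogonal projection of the final measurement on the auxiliary system that signals
  success -/
  success : Matrix A A ℂ
  success_isHermitian : success.IsHermitian
  success_idem : success * success = success

namespace QueryCircuit

variable {d N : ℕ} {A : Type*} [Fintype A] [DecidableEq A]

/-- The total unitary operation `Z(U)` of the circuit. -/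
def totalOp (C : QueryCircuit d N A) (U : SUGroup d) : Matrix (Fin d × A) (Fin d × A) ℂ :=
  interleave U.1 C.gate

/-- The unnormalized state of the main system, for the pure input `ψ`, after the success outcome
was obtained and the auxiliary system was discarded. Its trace is the probability of success. -/
def successOutput (C : QueryCircuit d N A) (U : SUGroup d) (ψ : Fin d → ℂ) :
    Matrix (Fin d) (Fin d) ℂ :=
  partialTraceAux
    (((1 : Matrix (Fin d) (Fin d) ℂ) ⊗ₖ C.success) *
      (C.totalOp U * (ketbra ψ ⊗ₖ C.auxState) * (C.totalOp U).conjTranspose) *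
      ((1 : Matrix (Fin d) (Fin d) ℂ) ⊗ₖ C.success).conjTranspose)

/-- On the black box `U`, the circuit implements `W` exactly with success probability `q`: for
every pure input state `ψ`, success occurs with probability `q` and the state of the main system
is then `W ψ` (up to a global phase). -/
def Implements (C : QueryCircuit d N A) (U : SUGroup d) (W : Matrix (Fin d) (Fin d) ℂ)
    (q : ℝ) : Prop :=
  ∀ ψ : Fin d → ℂ, dotProduct (star ψ) ψ = 1 →
    C.successOutput U ψ = (q : ℂ) • ketbra (W.mulVec ψ)

end QueryCircuit

/-- Differentiability at `U₀` of a real function on `SU(d)`, as an embedded submanifold of the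
real vector space of complex `d × d` matrices: the function is the restriction of a function on
that space which is (Fréchet, over `ℝ`) differentiable at `U₀`. -/
def SUDifferentiableAt {d : ℕ} (p : SUGroup d → ℝ) (U₀ : SUGroup d) : Prop :=
  ∃ P : Matrix (Fin d) (Fin d) ℂ → ℝ, (∀ U : SUGroup d, P U.1 = p U) ∧ DifferentiableAt ℝ P U₀.1

end

/-! Write `ρ_A = S S†` and `M(U) = (I ⊗ P) Z(U) (I ⊗ S)`. Its blocks between auxiliary basis vectors
are the Kraus operators of the success branch, so exactness forces each of them to be a multiple of
`Uᵀ`: `M(U) = Uᵀ ⊗ v(U)` with `‖v(U)‖² = p(U)` in Frobenius norm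
(`QueryCircuit.Implements.exists_eq_kronecker`).

Differentiating along `U₀ exp(tX)` with `X ∈ 𝔰𝔲(d)` shows that `D(X) = (I ⊗ P) Z'(U₀X) (Ū₀ ⊗ S) - Xᵀ
⊗ v₀` has the form `I ⊗ w(X)` (`nonScalarPart_interleaveDeriv`). By homogeneity of degree `N`, `D(1)
= I ⊗ (N - 1)v₀` has this form too, and complex linearity extends it to every matrix `X`
(`eq_zero_of_vanish_on_specialUnitary`).

Now multiply by `I ⊗ v₀†` and contract with `crossTrace`. The term `Xᵀ ⊗ v₀` gives `d²‖v₀‖²` and `I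
⊗ w(X)` gives `(N - 1)‖v₀‖²`, while Cauchy–Schwarz bounds each of the `N` query terms by `√d ‖v₀‖ ·
√d` (`norm_crossTrace_interleaveDeriv_le`). Hence `(d² - 1 + N)‖v₀‖² ≤ N d ‖v₀‖`, which is the
bound. Gate teleportation attains it for `N = 1`. -/

/-! ### Frobenius norm and its unitary invariance. -/

section FrobeniusSquare

variable {m n l : Type*} [Fintype m] [Fintype n] [Fintype l]

/-- The square of the Frobenius norm of a complex matrix. -/
noncomputable def frobSq (M : Matrix m n ℂ) : ℝ := ∑ i, ∑ j, ‖M i j‖ ^ 2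

theorem frobSq_nonneg (M : Matrix m n ℂ) : 0 ≤ frobSq M :=
  Finset.sum_nonneg fun _ _ => Finset.sum_nonneg fun _ _ => sq_nonneg _

theorem trace_mul_conjTranspose_eq_frobSq (M : Matrix m n ℂ) :
    (M * M.conjTranspose).trace = (frobSq M : ℂ) := by
  simp only [Matrix.trace, Matrix.diag_apply, Matrix.mul_apply, Matrix.conjTranspose_apply, frobSq,
    Complex.ofReal_sum]
  refine Finset.sum_congr rfl fun i _ => Finset.sum_congr rfl fun j _ => ?_
  rw [Complex.star_def, Complex.mul_conj, Complex.normSq_eq_norm_sq]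

theorem frobSq_conjTranspose (M : Matrix m n ℂ) : frobSq M.conjTranspose = frobSq M := by
  unfold frobSq
  rw [Finset.sum_comm]
  simp

theorem frobSq_mul_unitary [DecidableEq n] (M : Matrix m n ℂ) {U : Matrix n n ℂ}
    (hU : U ∈ Matrix.unitaryGroup n ℂ) : frobSq (M * U) = frobSq M := by
  have h : ((frobSq (M * U) : ℝ) : ℂ) = (frobSq M : ℝ) := by
    rw [← trace_mul_conjTranspose_eq_frobSq, ← trace_mul_conjTranspose_eq_frobSq,
      Matrix.conjTranspose_mul, Matrix.mul_assoc, ← Matrix.mul_assoc U,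
      ← Matrix.star_eq_conjTranspose U, Matrix.mem_unitaryGroup_iff.mp hU, Matrix.one_mul]
  exact_mod_cast h

theorem frobSq_unitary_mul [DecidableEq m] (M : Matrix m n ℂ) {U : Matrix m m ℂ}
    (hU : U ∈ Matrix.unitaryGroup m ℂ) : frobSq (U * M) = frobSq M := by
  rw [← frobSq_conjTranspose, Matrix.conjTranspose_mul, ← Matrix.star_eq_conjTranspose U,
    frobSq_mul_unitary _ (Unitary.star_mem hU), frobSq_conjTranspose]

theorem frobSq_one [DecidableEq m] : frobSq (1 : Matrix m m ℂ) = Fintype.card m := by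
  simp [frobSq, Matrix.one_apply, apply_ite]

theorem frobSq_unitary [DecidableEq m] {U : Matrix m m ℂ} (hU : U ∈ Matrix.unitaryGroup m ℂ) :
    frobSq U = Fintype.card m := by
  rw [← mul_one U, frobSq_unitary_mul _ hU, frobSq_one]

theorem frobSq_kronecker {A B : Type*} [Fintype A] [Fintype B] (M : Matrix m n ℂ)
    (K : Matrix A B ℂ) : frobSq (M ⊗ₖ K) = frobSq M * frobSq K := by
  simp only [frobSq, Fintype.sum_prod_type, Matrix.kronecker_apply, norm_mul, mul_pow,
    Finset.sum_mul_sum]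

end FrobeniusSquare

/-! ### The contraction and its bound on the derivative of the circuit. -/

section CrossTrace

variable {d : ℕ} {A : Type*} [Fintype A]

/-- The contraction `∑ₘₙ Tr[(Eₘₙ ⊗ I) T(Eₘₙ)]` of a matrix-valued function `T`, where `Eₘₙ` are
the matrix units. -/
noncomputable def crossTrace (T : Matrix (Fin d) (Fin d) ℂ → Matrix (Fin d × A) (Fin d × A) ℂ) : ℂ :=
  ∑ m, ∑ n, ∑ b, T (Matrix.single m n 1) (n, b) (m, b)

theorem crossTrace_add (S T : Matrix (Fin d) (Fin d) ℂ → Matrix (Fin d × A) (Fin d × A) ℂ) :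
    crossTrace (fun X => S X + T X) = crossTrace S + crossTrace T := by
  simp [crossTrace, Finset.sum_add_distrib]

variable [DecidableEq A]

theorem mul_single_kronecker_mul_apply (Y C : Matrix (Fin d × A) (Fin d × A) ℂ) (m n : Fin d)
    (p q : Fin d × A) :
    (Y * (Matrix.single m n (1 : ℂ) ⊗ₖ (1 : Matrix A A ℂ)) * C) p q =
      ∑ c, Y p (m, c) * C (n, c) q := by
  simp only [Matrix.mul_apply, Fintype.sum_prod_type, Matrix.kronecker_apply,
    Matrix.single_apply, Matrix.one_apply]
  simp [ite_and]

/-- The contraction of a single query is bounded by Frobenius norms (Cauchy–Schwarz). -/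
theorem norm_crossTrace_query_le (Y C : Matrix (Fin d × A) (Fin d × A) ℂ) :
    ‖crossTrace (fun X => Y * (X ⊗ₖ (1 : Matrix A A ℂ)) * C)‖ ≤ √(frobSq Y) * √(frobSq C) := by
  -- Every entry of `Y` and every entry of `C` occurs in exactly one summand, so Cauchy–Schwarz
  -- yields the two Frobenius norms with no dimension factor.
  have key : crossTrace (fun X => Y * (X ⊗ₖ (1 : Matrix A A ℂ)) * C) =
      ∑ z : Fin d × Fin d × A × A,
        Y (z.2.1, z.2.2.1) (z.1, z.2.2.2) * C (z.2.1, z.2.2.2) (z.1, z.2.2.1) := by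
    simp only [crossTrace, mul_single_kronecker_mul_apply, Fintype.sum_prod_type]
  have hY : ∑ z : Fin d × Fin d × A × A, ‖Y (z.2.1, z.2.2.1) (z.1, z.2.2.2)‖ ^ 2 = frobSq Y := by
    simp only [frobSq, Fintype.sum_prod_type]
    exact Finset.sum_comm.trans (Finset.sum_congr rfl fun n _ => Finset.sum_comm)
  have hC : ∑ z : Fin d × Fin d × A × A, ‖C (z.2.1, z.2.2.2) (z.1, z.2.2.1)‖ ^ 2 = frobSq C := by
    simp only [frobSq, Fintype.sum_prod_type]
    refine Finset.sum_comm.trans (Finset.sum_congr rfl fun n _ => ?_)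
    exact (Finset.sum_congr rfl fun m _ => Finset.sum_comm).trans Finset.sum_comm
  rw [key, ← hY, ← hC]
  refine (norm_sum_le _ _).trans ?_
  simp only [norm_mul]
  exact Real.sum_mul_le_sqrt_mul_sqrt _ _ _

/-- The derivative of `interleave U V` at `U` in the direction `T`. -/
noncomputable def interleaveDeriv (U T : Matrix (Fin d) (Fin d) ℂ) :
    {N : ℕ} → (Fin (N + 1) → Matrix (Fin d × A) (Fin d × A) ℂ) →
      Matrix (Fin d × A) (Fin d × A) ℂ
  | 0, _ => 0
  | n + 1, V =>
      V (Fin.last (n + 1)) * (T ⊗ₖ (1 : Matrix A A ℂ)) *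
          interleave U (fun j : Fin (n + 1) => V j.castSucc) +
        V (Fin.last (n + 1)) * (U ⊗ₖ (1 : Matrix A A ℂ)) *
          interleaveDeriv U T (fun j : Fin (n + 1) => V j.castSucc)

theorem interleaveDeriv_add (U S T : Matrix (Fin d) (Fin d) ℂ) {N : ℕ}
    (V : Fin (N + 1) → Matrix (Fin d × A) (Fin d × A) ℂ) :
    interleaveDeriv U (S + T) V = interleaveDeriv U S V + interleaveDeriv U T V := by
  induction N with
  | zero => simp [interleaveDeriv]
  | succ n ih =>
    simp only [interleaveDeriv, ih, Matrix.add_kronecker, Matrix.mul_add, Matrix.add_mul]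
    abel

theorem interleaveDeriv_smul (U : Matrix (Fin d) (Fin d) ℂ) (c : ℂ) (T : Matrix (Fin d) (Fin d) ℂ)
    {N : ℕ} (V : Fin (N + 1) → Matrix (Fin d × A) (Fin d × A) ℂ) :
    interleaveDeriv U (c • T) V = c • interleaveDeriv U T V := by
  induction N with
  | zero => simp [interleaveDeriv]
  | succ n ih =>
    simp only [interleaveDeriv, ih, Matrix.smul_kronecker, Matrix.mul_smul, Matrix.smul_mul,
      smul_add]

/-- Euler's identity for the homogeneous function `interleave` of degree `N`. -/
theorem interleaveDeriv_self (U : Matrix (Fin d) (Fin d) ℂ) {N : ℕ}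
    (V : Fin (N + 1) → Matrix (Fin d × A) (Fin d × A) ℂ) :
    interleaveDeriv U U V = (N : ℂ) • interleave U V := by
  induction N with
  | zero => simp [interleaveDeriv]
  | succ n ih =>
    simp only [interleaveDeriv, ih, interleave, Matrix.mul_smul, Nat.cast_add, Nat.cast_one,
      add_smul, one_smul]
    abel

theorem kronecker_one_mem_unitaryGroup {U : Matrix (Fin d) (Fin d) ℂ}
    (hU : U ∈ Matrix.unitaryGroup (Fin d) ℂ) :
    U ⊗ₖ (1 : Matrix A A ℂ) ∈ Matrix.unitaryGroup (Fin d × A) ℂ :=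
  Matrix.kronecker_mem_unitary hU (one_mem _)

theorem interleave_mem_unitaryGroup {U : Matrix (Fin d) (Fin d) ℂ}
    (hU : U ∈ Matrix.unitaryGroup (Fin d) ℂ) {N : ℕ}
    {V : Fin (N + 1) → Matrix (Fin d × A) (Fin d × A) ℂ}
    (hV : ∀ j, V j ∈ Matrix.unitaryGroup (Fin d × A) ℂ) :
    interleave U V ∈ Matrix.unitaryGroup (Fin d × A) ℂ := by
  induction N with
  | zero => exact hV 0
  | succ n ih =>
    exact mul_mem (mul_mem (hV _) (kronecker_one_mem_unitaryGroup hU)) (ih fun j => hV _)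

/-- Each of the `N` queries contributes at most a product of Frobenius norms to the contraction of
the derivative. -/
theorem norm_crossTrace_interleaveDeriv_le {U : Matrix (Fin d) (Fin d) ℂ}
    (hU : U ∈ Matrix.unitaryGroup (Fin d) ℂ) {N : ℕ}
    {V : Fin (N + 1) → Matrix (Fin d × A) (Fin d × A) ℂ}
    (hV : ∀ j, V j ∈ Matrix.unitaryGroup (Fin d × A) ℂ) (Y R : Matrix (Fin d × A) (Fin d × A) ℂ) :
    ‖crossTrace (fun X => Y * interleaveDeriv U (U * X) V * R)‖ ≤
      N * (√(frobSq Y) * √(frobSq R)) := by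
  induction N generalizing Y with
  | zero => simp [interleaveDeriv, crossTrace]
  | succ n ih =>
    have hU' := kronecker_one_mem_unitaryGroup (A := A) hU
    have hW : V (Fin.last (n + 1)) * (U ⊗ₖ (1 : Matrix A A ℂ)) ∈
        Matrix.unitaryGroup (Fin d × A) ℂ := mul_mem (hV _) hU'
    set W := V (Fin.last (n + 1)) * (U ⊗ₖ (1 : Matrix A A ℂ)) with hWdef
    set V' := fun j : Fin (n + 1) => V j.castSucc with hV'
    have hI : interleave U V' ∈ Matrix.unitaryGroup (Fin d × A) ℂ :=
      interleave_mem_unitaryGroup hU fun j => hV _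
    -- Product rule at the last query. The unitary `W` is absorbed into `Y`, whose Frobenius norm
    -- does not change; this is why the induction runs over all `Y`.
    have split : (fun X => Y * interleaveDeriv U (U * X) V * R) = fun X =>
        (Y * W) * (X ⊗ₖ (1 : Matrix A A ℂ)) * (interleave U V' * R) +
          (Y * W) * interleaveDeriv U (U * X) V' * R := by
      funext X
      have : (U * X) ⊗ₖ (1 : Matrix A A ℂ) = (U ⊗ₖ (1 : Matrix A A ℂ)) * (X ⊗ₖ 1) := by
        rw [← Matrix.mul_kronecker_mul, Matrix.one_mul]
      simp only [interleaveDeriv, this, hWdef, hV', Matrix.mul_add, Matrix.add_mul,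
        Matrix.mul_assoc]
    rw [split, crossTrace_add]
    have h1 := norm_crossTrace_query_le (Y * W) (interleave U V' * R)
    have h2 := ih (V := V') (fun j => hV _) (Y * W)
    rw [frobSq_mul_unitary _ hW] at h1 h2
    rw [frobSq_unitary_mul _ hI] at h1
    refine (norm_add_le _ _).trans ((add_le_add h1 h2).trans (le_of_eq ?_))
    push_cast
    ring

end CrossTrace

/-! ### Exponentials of `𝔰𝔲(d)` lie in `SU(d)`. -/

section SpecialUnitaryExp

variable {n : Type*} [Fintype n] [DecidableEq n]

/-- Unitary diagonalization reduces this to a product of scalar exponentials. A skew-Hermitian `X`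
is covered by `H = iX`, `c = -i`. -/
theorem Matrix.IsHermitian.det_exp_smul {H : Matrix n n ℂ} (hH : H.IsHermitian) (c : ℂ) :
    (NormedSpace.exp (c • H)).det = Complex.exp (c * H.trace) := by
  set W : Matrix n n ℂ := (hH.eigenvectorUnitary : Matrix n n ℂ) with hW
  have hWW : W * star W = 1 := Unitary.coe_mul_star_self hH.eigenvectorUnitary
  have hinv : W⁻¹ = star W := Matrix.inv_eq_right_inv hWW
  have hunit : IsUnit W := IsUnit.of_mul_eq_one _ hWW
  have hdet : IsUnit W.det := (Matrix.isUnit_iff_isUnit_det W).mp hunit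
  have hs : c • H = W * Matrix.diagonal (fun i => c * (hH.eigenvalues i : ℂ)) * W⁻¹ := by
    have h : H = W * Matrix.diagonal (fun i => (hH.eigenvalues i : ℂ)) * star W := by
      conv_lhs => rw [hH.spectral_theorem]
      rfl
    have hd : Matrix.diagonal (fun i => c * (hH.eigenvalues i : ℂ)) =
        c • Matrix.diagonal (fun i => (hH.eigenvalues i : ℂ)) := by
      rw [← Matrix.diagonal_smul]; rfl
    rw [hinv, hd, Matrix.mul_smul, Matrix.smul_mul, ← h]
  rw [hs, Matrix.exp_conj _ _ hunit, Matrix.exp_diagonal, Matrix.det_mul, Matrix.det_mul,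
    mul_right_comm, ← Matrix.det_mul, Matrix.mul_nonsing_inv _ hdet, Matrix.det_one, one_mul,
    Matrix.det_diagonal, hH.trace_eq_sum_eigenvalues, Finset.mul_sum, Complex.exp_sum]
  refine Finset.prod_congr rfl fun i _ => ?_
  rw [Pi.coe_exp, Complex.exp_eq_exp_ℂ]
  rfl

theorem exp_mem_specialUnitaryGroup {X : Matrix n n ℂ} (hX : star X = -X) (htr : X.trace = 0) :
    NormedSpace.exp X ∈ Matrix.specialUnitaryGroup n ℂ := by
  refine Matrix.mem_specialUnitaryGroup_iff.mpr ⟨?_, ?_⟩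
  · rw [Matrix.mem_unitaryGroup_iff, Matrix.star_eq_conjTranspose, ← Matrix.exp_conjTranspose,
      ← Matrix.star_eq_conjTranspose, hX, ← Matrix.exp_add_of_commute _ _ ((Commute.refl X).neg_right),
      add_neg_cancel, NormedSpace.exp_zero]
  · have hH : (Complex.I • X).IsHermitian := by
      rw [Matrix.IsHermitian, Matrix.conjTranspose_smul, ← Matrix.star_eq_conjTranspose, hX]
      simp
    have h := hH.det_exp_smul (-Complex.I)
    rw [smul_smul, Matrix.trace_smul, htr] at h
    simpa using h

end SpecialUnitaryExp

/-! ### Operators of the form `I ⊗ w`, and complexification of `𝔰𝔲(d)`. -/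

section NonScalarPart

variable {d : ℕ} {A : Type*}

/-- The difference between an operator on `ℂ^d ⊗ ℂ^A` and `I ⊗ w`, where `w` is its diagonal block
at `i₀`. -/
noncomputable def nonScalarPart (A : Type*) (i₀ : Fin d) :
    Matrix (Fin d × A) (Fin d × A) ℂ →ₗ[ℂ] Matrix (Fin d × A) (Fin d × A) ℂ where
  toFun T := T - (1 : Matrix (Fin d) (Fin d) ℂ) ⊗ₖ T.submatrix (Prod.mk i₀) (Prod.mk i₀)
  map_add' S T := by
    ext ⟨i, a⟩ ⟨j, b⟩
    simp only [Matrix.add_apply, Matrix.sub_apply, Matrix.kronecker_apply, Matrix.submatrix_apply]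
    ring
  map_smul' c T := by
    ext ⟨i, a⟩ ⟨j, b⟩
    simp only [Matrix.smul_apply, Matrix.sub_apply, Matrix.kronecker_apply, Matrix.submatrix_apply,
      RingHom.id_apply, smul_eq_mul]
    ring

theorem nonScalarPart_one_kronecker (i₀ : Fin d) (w : Matrix A A ℂ) :
    nonScalarPart A i₀ ((1 : Matrix (Fin d) (Fin d) ℂ) ⊗ₖ w) = 0 := by
  ext ⟨i, a⟩ ⟨j, b⟩
  simp [nonScalarPart]

theorem eq_one_kronecker_of_nonScalarPart_eq_zero {i₀ : Fin d}
    {T : Matrix (Fin d × A) (Fin d × A) ℂ} (h : nonScalarPart A i₀ T = 0) :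
    T = (1 : Matrix (Fin d) (Fin d) ℂ) ⊗ₖ T.submatrix (Prod.mk i₀) (Prod.mk i₀) :=
  sub_eq_zero.mp h

/-- A complex linear map that vanishes on the Lie algebra `𝔰𝔲(d)` and at the identity is zero. -/
theorem eq_zero_of_vanish_on_specialUnitary {E : Type*} [AddCommGroup E] [Module ℂ E] (hd : 0 < d)
    (Φ : Matrix (Fin d) (Fin d) ℂ →ₗ[ℂ] E) (h1 : Φ 1 = 0)
    (hΦ : ∀ X, star X = -X → X.trace = 0 → Φ X = 0) : Φ = 0 := by
  have hd' : (d : ℂ) ≠ 0 := by exact_mod_cast hd.ne'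
  have skew : ∀ X, star X = -X → Φ X = 0 := fun X hX => by
    have htr : star X.trace = -X.trace := by
      rw [← Matrix.trace_conjTranspose, ← Matrix.star_eq_conjTranspose, hX, Matrix.trace_neg]
    -- Removing the trace part lands in `𝔰𝔲(d)`; `Φ 1 = 0` makes this harmless.
    have h := hΦ (X - (X.trace / d) • (1 : Matrix (Fin d) (Fin d) ℂ)) (by
      rw [star_sub, star_smul, hX, star_one, star_div₀, htr]
      simp [neg_div, neg_add_eq_sub]) (by
      rw [Matrix.trace_sub, Matrix.trace_smul, Matrix.trace_one, smul_eq_mul, Fintype.card_fin]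
      field_simp
      ring)
    rwa [map_sub, map_smul, h1, smul_zero, sub_zero] at h
  ext1 X
  have h₁ := skew (X - star X) (by simp)
  have h₂ := skew (Complex.I • (X + star X)) (by
    rw [star_smul, star_add, star_star, add_comm, Complex.star_def, Complex.conj_I, neg_smul])
  have hX : (2 : ℂ) • X = (X - star X) - Complex.I • (Complex.I • (X + star X)) := by
    rw [smul_smul, Complex.I_mul_I, two_smul, neg_one_smul]
    abel
  have h3 : (2 : ℂ) • Φ X = 0 := by
    rw [← map_smul, hX, map_sub, map_smul, h₁, h₂, smul_zero, sub_zero]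
  simpa using h3

end NonScalarPart

/-! ### Differentiating the factorization. -/

section Derivative

variable {d : ℕ} {A : Type*} [Fintype A] [DecidableEq A]

open scoped Matrix.Norms.Operator

theorem hasDerivAt_kronecker_one {γ : ℝ → Matrix (Fin d) (Fin d) ℂ}
    {γ' : Matrix (Fin d) (Fin d) ℂ} {t : ℝ} (h : HasDerivAt γ γ' t) :
    HasDerivAt (fun s => γ s ⊗ₖ (1 : Matrix A A ℂ)) (γ' ⊗ₖ (1 : Matrix A A ℂ)) t := by
  let κ : Matrix (Fin d) (Fin d) ℂ →ₗ[ℝ] Matrix (Fin d × A) (Fin d × A) ℂ :=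
    { toFun := fun T => T ⊗ₖ (1 : Matrix A A ℂ)
      map_add' := fun S T => Matrix.add_kronecker S T 1
      map_smul' := fun c T => Matrix.smul_kronecker c T 1 }
  exact κ.toContinuousLinearMap.hasFDerivAt.comp_hasDerivAt t h

theorem hasDerivAt_interleave {γ : ℝ → Matrix (Fin d) (Fin d) ℂ}
    {γ' : Matrix (Fin d) (Fin d) ℂ} {t : ℝ} (h : HasDerivAt γ γ' t) {N : ℕ}
    (V : Fin (N + 1) → Matrix (Fin d × A) (Fin d × A) ℂ) :
    HasDerivAt (fun s => interleave (γ s) V) (interleaveDeriv (γ t) γ' V) t := by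
  induction N with
  | zero => exact hasDerivAt_const t (V 0)
  | succ n ih =>
    exact ((hasDerivAt_kronecker_one (A := A) h).const_mul (V (Fin.last (n + 1)))).mul
      (ih fun j => V j.castSucc)

/-- A curve that stays in a linear subspace has its velocity there. The subspace of interest is that
of the operators `I ⊗ w`. -/
theorem map_eq_zero_of_hasDerivAt {E F : Type*} [NormedAddCommGroup E] [NormedSpace ℝ E]
    [FiniteDimensional ℝ E] [NormedAddCommGroup F] [NormedSpace ℝ F] (Φ : E →ₗ[ℝ] F)
    {f : ℝ → E} {f' : E} {t : ℝ} (hf : HasDerivAt f f' t) (h : ∀ᶠ s in 𝓝 t, Φ (f s) = 0) :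
    Φ f' = 0 := by
  have h₁ : HasDerivAt (fun s => Φ (f s)) (Φ f') t :=
    Φ.toContinuousLinearMap.hasFDerivAt.comp_hasDerivAt t hf
  have h₂ : HasDerivAt (fun s => Φ (f s)) 0 t :=
    (hasDerivAt_const t (0 : F)).congr_of_eventuallyEq h
  exact h₁.unique h₂

theorem transpose_mul_map_star {U : Matrix (Fin d) (Fin d) ℂ}
    (hU : U ∈ Matrix.unitaryGroup (Fin d) ℂ) : U.transpose * (star U).transpose = 1 := by
  rw [← Matrix.transpose_mul, Matrix.mem_unitaryGroup_iff'.mp hU, Matrix.transpose_one]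

/-- If near `U₀` the operator `L Z(U) (I ⊗ S)` factorizes as `Uᵀ ⊗ v(U)`, then differentiation
along `U₀ exp(tX)` gives a first-order relation that holds up to an operator `I ⊗ w`. -/
theorem nonScalarPart_interleaveDeriv {N : ℕ}
    {V : Fin (N + 1) → Matrix (Fin d × A) (Fin d × A) ℂ} {L : Matrix (Fin d × A) (Fin d × A) ℂ}
    {S : Matrix A A ℂ} {U₀ : SUGroup d} {v₀ : Matrix A A ℂ}
    (h₀ : L * interleave U₀.1 V * ((1 : Matrix (Fin d) (Fin d) ℂ) ⊗ₖ S) = U₀.1.transpose ⊗ₖ v₀)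
    (h : ∀ᶠ U : SUGroup d in 𝓝 U₀, ∃ v : Matrix A A ℂ,
      L * interleave U.1 V * ((1 : Matrix (Fin d) (Fin d) ℂ) ⊗ₖ S) = U.1.transpose ⊗ₖ v)
    (i₀ : Fin d) {X : Matrix (Fin d) (Fin d) ℂ} (hX : star X = -X) (htr : X.trace = 0) :
    nonScalarPart A i₀ (L * interleaveDeriv U₀.1 (U₀.1 * X) V * ((star U₀.1).transpose ⊗ₖ S) -
      X.transpose ⊗ₖ v₀) = 0 := by
  have hU₀ : U₀.1 ∈ Matrix.unitaryGroup (Fin d) ℂ :=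
    Matrix.specialUnitaryGroup_le_unitaryGroup U₀.2
  have hexp : ∀ t : ℝ, NormedSpace.exp (t • X) ∈ Matrix.specialUnitaryGroup (Fin d) ℂ := fun t =>
    exp_mem_specialUnitaryGroup (by rw [star_smul, hX]; simp)
      (by rw [Matrix.trace_smul, htr, smul_zero])
  let γ : ℝ → SUGroup d := fun t => U₀ * ⟨NormedSpace.exp (t • X), hexp t⟩
  have hE : HasDerivAt (fun t : ℝ => NormedSpace.exp (t • X)) X 0 := by
    have := hasDerivAt_exp_smul_const (𝕂 := ℝ) X 0
    rw [zero_smul, NormedSpace.exp_zero, one_mul] at this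
    exact this
  have hE' : HasDerivAt (fun t : ℝ => NormedSpace.exp (t • -X)) (-X) 0 := by
    have := hasDerivAt_exp_smul_const (𝕂 := ℝ) (-X) 0
    rw [zero_smul, NormedSpace.exp_zero, one_mul] at this
    exact this
  have hγ : HasDerivAt (fun t => (γ t).1) (U₀.1 * X) 0 := hE.const_mul U₀.1
  have hγ0 : (γ 0) = U₀ := by
    apply Subtype.ext
    simp [γ]
  have hγc : Filter.Tendsto γ (𝓝 0) (𝓝 U₀) := by
    rw [tendsto_subtype_rng]
    have := hγ.continuousAt.tendsto
    rwa [hγ0] at this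
  have hG : HasDerivAt
      (fun t => L * interleave (γ t).1 V * ((1 : Matrix (Fin d) (Fin d) ℂ) ⊗ₖ S))
      (L * interleaveDeriv U₀.1 (U₀.1 * X) V * ((1 : Matrix (Fin d) (Fin d) ℂ) ⊗ₖ S)) 0 := by
    have := ((hasDerivAt_interleave hγ V).const_mul L).mul_const
      ((1 : Matrix (Fin d) (Fin d) ℂ) ⊗ₖ S)
    rwa [hγ0] at this
  have hT : HasDerivAt (fun t : ℝ => (NormedSpace.exp (t • -X)).transpose) (-X).transpose 0 :=
    let τ := (Matrix.transposeLinearEquiv (Fin d) (Fin d) ℝ ℂ).toLinearMap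
    τ.toContinuousLinearMap.hasFDerivAt.comp_hasDerivAt 0 hE'
  -- The first tensor factor is the inverse of `γ(t)ᵀ`. Multiplying by it turns `γ(t)ᵀ ⊗ v` into `I
  -- ⊗ v`, so no regularity of `v` in `t` is needed.
  have hK : HasDerivAt
      (fun t : ℝ => ((star U₀.1).transpose * (NormedSpace.exp (t • -X)).transpose) ⊗ₖ
        (1 : Matrix A A ℂ))
      (((star U₀.1).transpose * (-X).transpose) ⊗ₖ (1 : Matrix A A ℂ)) 0 :=
    hasDerivAt_kronecker_one (hT.const_mul _)
  have hF := hG.mul hK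
  have hmem := map_eq_zero_of_hasDerivAt ((nonScalarPart A i₀).restrictScalars ℝ) hF (by
    filter_upwards [hγc.eventually h] with t ht
    obtain ⟨v, hv⟩ := ht
    have hinv : (γ t).1.transpose *
        ((star U₀.1).transpose * (NormedSpace.exp (t • -X)).transpose) = 1 := by
      have h1 : (NormedSpace.exp (t • X)).transpose * (NormedSpace.exp (t • -X)).transpose = 1 := by
        rw [← Matrix.transpose_mul, ← Matrix.exp_add_of_commute _ _
          (Commute.smul_left (Commute.smul_right (Commute.refl X).neg_left t) t)]
        simp
      change (U₀.1 * NormedSpace.exp (t • X)).transpose * _ = 1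
      rw [Matrix.transpose_mul, Matrix.mul_assoc, ← Matrix.mul_assoc U₀.1.transpose,
        transpose_mul_map_star hU₀, Matrix.one_mul, h1]
    simp only [Pi.mul_apply, LinearMap.restrictScalars_apply]
    rw [hv, ← Matrix.mul_kronecker_mul, hinv, Matrix.mul_one, nonScalarPart_one_kronecker])
  rw [LinearMap.restrictScalars_apply] at hmem
  convert hmem using 2
  rw [hγ0, h₀, Matrix.mul_assoc _ (1 ⊗ₖ S), ← Matrix.mul_kronecker_mul, ← Matrix.mul_kronecker_mul,
    ← Matrix.mul_assoc U₀.1.transpose, transpose_mul_map_star hU₀]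
  have hneg : (-X.transpose) ⊗ₖ v₀ = -(X.transpose ⊗ₖ v₀) := by
    ext ⟨i, a⟩ ⟨j, b⟩
    simp
  simp [hneg, sub_eq_add_neg]

end Derivative

/-! ### Exact implementation forces proportional Kraus operators. -/

section Factorization

variable {d : ℕ} {A : Type*} [Fintype A] [DecidableEq A]

theorem mul_ketbra_mul_conjTranspose {m n : Type*} [Fintype n] (M : Matrix m n ℂ) (x : n → ℂ) :
    M * ketbra x * M.conjTranspose = ketbra (M.mulVec x) := by
  rw [ketbra, Matrix.mul_vecMulVec, Matrix.vecMulVec_mul, ketbra, Matrix.star_mulVec]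

theorem partialTraceAux_kronecker_one_conj (K : Matrix (Fin d) (Fin d) ℂ)
    (T : Matrix (Fin d × A) (Fin d × A) ℂ) :
    partialTraceAux ((K ⊗ₖ (1 : Matrix A A ℂ)) * T * (K ⊗ₖ (1 : Matrix A A ℂ)).conjTranspose) =
      K * partialTraceAux T * K.conjTranspose := by
  ext i j
  simp only [partialTraceAux, Matrix.of_apply, Matrix.mul_apply, Fintype.sum_prod_type,
    Matrix.kronecker_apply, Matrix.conjTranspose_apply, Matrix.one_apply, mul_ite, mul_one,
    mul_zero, ite_mul, zero_mul, Finset.sum_ite_eq, Finset.mem_univ, if_true, apply_ite star, star_zero,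
    Finset.sum_mul, Finset.mul_sum]
  rw [Finset.sum_comm]
  refine Finset.sum_congr rfl fun k _ => ?_
  refine (Finset.sum_congr rfl fun a _ => ?_).trans Finset.sum_comm
  rw [Finset.sum_eq_single a (fun b _ hb => by simp [hb.symm]) (by simp)]
  simp

/-- This is the Kraus form of the operation: each pair `z` of auxiliary output and input indices
labels one Kraus operator, a block of `Q`. -/
theorem partialTraceAux_mul_ketbra_apply (Q : Matrix (Fin d × A) (Fin d × A) ℂ) (ψ : Fin d → ℂ)
    (i j : Fin d) :
    partialTraceAux (Q * (ketbra ψ ⊗ₖ (1 : Matrix A A ℂ)) * Q.conjTranspose) i j =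
      ∑ z : A × A, (∑ l, Q (i, z.1) (l, z.2) * ψ l) *
        star (∑ l, Q (j, z.1) (l, z.2) * ψ l) := by
  simp only [partialTraceAux, Matrix.of_apply, Matrix.mul_apply, Fintype.sum_prod_type,
    Matrix.kronecker_apply, Matrix.conjTranspose_apply, Matrix.one_apply, mul_ite, mul_one,
    mul_zero, Finset.sum_ite_eq', Finset.mem_univ, if_true, ketbra, Matrix.vecMulVec_apply,
    Pi.star_apply]
  refine Finset.sum_congr rfl fun b _ => ?_
  rw [Finset.sum_comm]
  refine Finset.sum_congr rfl fun k _ => ?_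
  rw [star_sum, Finset.mul_sum]
  refine Finset.sum_congr rfl fun l _ => ?_
  rw [Finset.sum_mul, Finset.sum_mul]
  refine Finset.sum_congr rfl fun l' _ => ?_
  rw [star_mul']
  ring

theorem eq_zero_of_sum_mul_star_eq_zero {ι : Type*} [Fintype ι] {x : ι → ℂ}
    (h : ∑ z, x z * star (x z) = 0) (z : ι) : x z = 0 := by
  have h' : x ⬝ᵥ star x = 0 := h
  exact congrFun (dotProduct_star_self_eq_zero.mp ((dotProduct_comm _ _).trans h')) z

/-- An operation whose output on every pure state `ψ` is `q |ψ⟩⟨ψ|` has all its Kraus operators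
scalar. -/
theorem exists_eq_one_kronecker (hd : 0 < d) {Q : Matrix (Fin d × A) (Fin d × A) ℂ} {q : ℝ}
    (h : ∀ ψ : Fin d → ℂ, star ψ ⬝ᵥ ψ = 1 →
      partialTraceAux (Q * (ketbra ψ ⊗ₖ (1 : Matrix A A ℂ)) * Q.conjTranspose) =
        (q : ℂ) • ketbra ψ) :
    ∃ v : Matrix A A ℂ, Q = (1 : Matrix (Fin d) (Fin d) ℂ) ⊗ₖ v ∧ frobSq v = q := by
  have basis : ∀ i j, ∑ z : A × A, Q (i, z.1) (j, z.2) * star (Q (i, z.1) (j, z.2)) =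
      if i = j then (q : ℂ) else 0 := fun i j => by
    have h₁ := congrFun (congrFun (h (Pi.single j 1) (by simp)) i) i
    rw [partialTraceAux_mul_ketbra_apply] at h₁
    simp only [Pi.single_apply, mul_ite, mul_one, mul_zero, Finset.sum_ite_eq', Finset.mem_univ,
      if_true] at h₁
    rw [h₁]
    by_cases hij : i = j <;> simp [ketbra, Matrix.vecMulVec_apply, hij]
  have offDiag : ∀ i j, i ≠ j → ∀ b k, Q (i, b) (j, k) = 0 := fun i j hij b k => by
    have h₁ := basis i j
    rw [if_neg hij] at h₁
    exact eq_zero_of_sum_mul_star_eq_zero (x := fun z : A × A => Q (i, z.1) (j, z.2)) h₁ (b, k)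
  -- Tested on `(eᵢ + eⱼ)/√2`: the `(i, j)` entry of the output is the inner product of the two
  -- diagonal families, up to a factor `1/2`.
  have cross : ∀ i j, i ≠ j →
      ∑ z : A × A, Q (i, z.1) (i, z.2) * star (Q (j, z.1) (j, z.2)) = (q : ℂ) := fun i j hij => by
    set r : ℂ := (((√2)⁻¹ : ℝ) : ℂ) with hr
    have hrr : r * r = 2⁻¹ := by
      rw [hr, ← Complex.ofReal_mul, ← mul_inv, Real.mul_self_sqrt (by norm_num)]
      norm_num
    have hrs : star r = r := Complex.conj_ofReal _
    let ψ : Fin d → ℂ := fun l => if l = i then r else if l = j then r else 0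
    have hψi : ψ i = r := if_pos rfl
    have hψj : ψ j = r := by simp [ψ, hij.symm]
    have hnorm : star ψ ⬝ᵥ ψ = 1 := by
      have hs : ∀ l, star (ψ l) * ψ l = (if l = i then 2⁻¹ else 0) + (if l = j then 2⁻¹ else 0) :=
        fun l => by
          by_cases hli : l = i
          · simp [ψ, hli, hij, hrs, hrr]
          · by_cases hlj : l = j
            · simp [ψ, hlj, hij.symm, hrs, hrr]
            · simp [ψ, hli, hlj]
      simp only [dotProduct, Pi.star_apply, hs, Finset.sum_add_distrib, Finset.sum_ite_eq',
        Finset.mem_univ, if_true]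
      norm_num
    have h₁ := congrFun (congrFun (h ψ hnorm) i) j
    rw [partialTraceAux_mul_ketbra_apply] at h₁
    have single : ∀ i' b k, ∑ l, Q (i', b) (l, k) * ψ l = Q (i', b) (i', k) * ψ i' :=
      fun i' b k => Finset.sum_eq_single i' (fun l _ hl => by
        rw [offDiag i' l hl.symm, zero_mul]) (by simp)
    simp only [single, hψi, hψj, star_mul', hrs, Matrix.smul_apply, ketbra, Matrix.vecMulVec_apply,
      Pi.star_apply, smul_eq_mul, hrr] at h₁
    have h₂ : (∑ z : A × A, Q (i, z.1) (i, z.2) * star (Q (j, z.1) (j, z.2))) * 2⁻¹ =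
        (q : ℂ) * 2⁻¹ := by
      rw [← h₁, Finset.sum_mul]
      refine Finset.sum_congr rfl fun z _ => ?_
      rw [← hrr]
      ring
    exact mul_right_cancel₀ (by norm_num) h₂
  have diag : ∀ i j b k, Q (i, b) (i, k) = Q (j, b) (j, k) := fun i j b k => by
    by_cases hij : i = j
    · rw [hij]
    -- The squared distance of the two families expands to `q - q - q + q = 0`.
    refine sub_eq_zero.mp (eq_zero_of_sum_mul_star_eq_zero
      (x := fun z : A × A => Q (i, z.1) (i, z.2) - Q (j, z.1) (j, z.2)) ?_ (b, k))
    have h₁ := basis i i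
    have h₂ := basis j j
    rw [if_pos rfl] at h₁ h₂
    simp only [star_sub, sub_mul, mul_sub, Finset.sum_sub_distrib, h₁, h₂, cross i j hij,
      cross j i (Ne.symm hij), sub_self]
  let i₀ : Fin d := ⟨0, hd⟩
  refine ⟨Q.submatrix (Prod.mk i₀) (Prod.mk i₀), ?_, ?_⟩
  · ext ⟨i, b⟩ ⟨j, k⟩
    by_cases hij : i = j
    · subst hij
      simpa using diag i i₀ b k
    · simp [offDiag i j hij, Matrix.one_apply_ne hij]
  · have h₁ := basis i₀ i₀
    rw [if_pos rfl, Fintype.sum_prod_type] at h₁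
    have h₂ : ((frobSq (Q.submatrix (Prod.mk i₀) (Prod.mk i₀)) : ℝ) : ℂ) = q := by
      rw [← h₁, ← trace_mul_conjTranspose_eq_frobSq]
      simp [Matrix.trace, Matrix.mul_apply]
    exact_mod_cast h₂

/-- Moving `S` into the circuit operator replaces the auxiliary state by the identity, so that the
Kraus form applies. -/
theorem QueryCircuit.successOutput_eq {N : ℕ} (C : QueryCircuit d N A) {S : Matrix A A ℂ}
    (hS : C.auxState = S * S.conjTranspose) (U : SUGroup d) (ψ : Fin d → ℂ) :
    C.successOutput U ψ = partialTraceAux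
      ((((1 : Matrix (Fin d) (Fin d) ℂ) ⊗ₖ C.success) * interleave U.1 C.gate *
          ((1 : Matrix (Fin d) (Fin d) ℂ) ⊗ₖ S)) * (ketbra ψ ⊗ₖ (1 : Matrix A A ℂ)) *
        (((1 : Matrix (Fin d) (Fin d) ℂ) ⊗ₖ C.success) * interleave U.1 C.gate *
          ((1 : Matrix (Fin d) (Fin d) ℂ) ⊗ₖ S)).conjTranspose) := by
  have hρ : ketbra ψ ⊗ₖ C.auxState = ((1 : Matrix (Fin d) (Fin d) ℂ) ⊗ₖ S) *
      (ketbra ψ ⊗ₖ (1 : Matrix A A ℂ)) * ((1 : Matrix (Fin d) (Fin d) ℂ) ⊗ₖ S).conjTranspose := by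
    rw [Matrix.conjTranspose_kronecker, ← Matrix.mul_kronecker_mul, ← Matrix.mul_kronecker_mul, hS]
    simp
  rw [QueryCircuit.successOutput, QueryCircuit.totalOp, hρ]
  simp only [Matrix.conjTranspose_mul, Matrix.mul_assoc]

/-- If a circuit implements a unitary `W` exactly, then its Kraus operators are multiples of `W`. -/
theorem QueryCircuit.Implements.exists_eq_kronecker (hd : 0 < d) {N : ℕ} {C : QueryCircuit d N A}
    {S : Matrix A A ℂ} (hS : C.auxState = S * S.conjTranspose) {U : SUGroup d}
    {W : Matrix (Fin d) (Fin d) ℂ} (hW : W ∈ Matrix.unitaryGroup (Fin d) ℂ) {q : ℝ}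
    (h : C.Implements U W q) :
    ∃ v : Matrix A A ℂ, ((1 : Matrix (Fin d) (Fin d) ℂ) ⊗ₖ C.success) * interleave U.1 C.gate *
      ((1 : Matrix (Fin d) (Fin d) ℂ) ⊗ₖ S) = W ⊗ₖ v ∧ frobSq v = q := by
  set M := ((1 : Matrix (Fin d) (Fin d) ℂ) ⊗ₖ C.success) * interleave U.1 C.gate *
    ((1 : Matrix (Fin d) (Fin d) ℂ) ⊗ₖ S) with hM
  have hWW : star W * W = 1 := Matrix.mem_unitaryGroup_iff'.mp hW
  obtain ⟨v, hv, hq⟩ := exists_eq_one_kronecker hd (Q := (star W ⊗ₖ (1 : Matrix A A ℂ)) * M)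
    (q := q) fun ψ hψ => by
      have h₁ := h ψ hψ
      rw [C.successOutput_eq hS, ← hM] at h₁
      have h₂ : (star W ⊗ₖ (1 : Matrix A A ℂ)) * M * (ketbra ψ ⊗ₖ (1 : Matrix A A ℂ)) *
            ((star W ⊗ₖ (1 : Matrix A A ℂ)) * M).conjTranspose =
          (star W ⊗ₖ (1 : Matrix A A ℂ)) * (M * (ketbra ψ ⊗ₖ (1 : Matrix A A ℂ)) *
            M.conjTranspose) * (star W ⊗ₖ (1 : Matrix A A ℂ)).conjTranspose := by
        simp only [Matrix.conjTranspose_mul, Matrix.mul_assoc]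
      rw [h₂, partialTraceAux_kronecker_one_conj, h₁, Matrix.mul_smul, Matrix.smul_mul,
        mul_ketbra_mul_conjTranspose, Matrix.mulVec_mulVec, hWW, Matrix.one_mulVec]
  refine ⟨v, ?_, hq⟩
  have h₃ : (W ⊗ₖ (1 : Matrix A A ℂ)) * ((star W ⊗ₖ (1 : Matrix A A ℂ)) * M) = M := by
    rw [← Matrix.mul_assoc, ← Matrix.mul_kronecker_mul, Matrix.mem_unitaryGroup_iff.mp hW]
    simp
  rw [← h₃, hv, ← Matrix.mul_kronecker_mul, Matrix.mul_one, Matrix.one_mul]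

end Factorization

/-! ### Gate teleportation attains `1/d²`. -/

section Teleportation

variable {d : ℕ}

/-- The maximally entangled unit vector `d^{-1/2} ∑ᵢ |i i⟩`. -/
noncomputable def maxEntangled (d : ℕ) : Fin d × Fin d → ℂ :=
  fun p => if p.1 = p.2 then ((√(d : ℝ))⁻¹ : ℝ) else 0

theorem ofReal_inv_sqrt_mul_self (d : ℕ) :
    (((√(d : ℝ))⁻¹ : ℝ) : ℂ) * (((√(d : ℝ))⁻¹ : ℝ) : ℂ) = (d : ℂ)⁻¹ := by
  rw [← Complex.ofReal_mul, ← mul_inv, Real.mul_self_sqrt (Nat.cast_nonneg d)]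
  simp

theorem star_maxEntangled (d : ℕ) : star (maxEntangled d) = maxEntangled d := by
  funext p
  simp only [Pi.star_apply, maxEntangled]
  split_ifs
  · exact Complex.conj_ofReal _
  · exact star_zero _

theorem maxEntangled_dotProduct (hd : 0 < d) : maxEntangled d ⬝ᵥ maxEntangled d = 1 := by
  have hd' : (d : ℂ) ≠ 0 := by exact_mod_cast hd.ne'
  simp only [dotProduct, maxEntangled, Fintype.sum_prod_type, mul_ite, mul_zero, Finset.sum_ite_eq,
    Finset.mem_univ, if_true, ofReal_inv_sqrt_mul_self, Finset.sum_const, Finset.card_univ,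
    Fintype.card_fin, nsmul_eq_mul]
  exact mul_inv_cancel₀ hd'

theorem permMatrix_mem_unitaryGroup {n : Type*} [Fintype n] [DecidableEq n] (σ : Equiv.Perm n) :
    σ.permMatrix ℂ ∈ Matrix.unitaryGroup n ℂ := by
  rw [Matrix.mem_unitaryGroup_iff, Matrix.star_eq_conjTranspose, Matrix.conjTranspose_permMatrix,
    ← Matrix.permMatrix_mul, inv_mul_cancel, Matrix.permMatrix_one]

/-- Exchange of the main system with the first auxiliary system. -/
def swapFirst (d : ℕ) : Equiv.Perm (Fin d × Fin d × Fin d) where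
  toFun x := (x.2.1, x.1, x.2.2)
  invFun x := (x.2.1, x.1, x.2.2)
  left_inv _ := rfl
  right_inv _ := rfl

/-- Exchange of the main system with the second auxiliary system. -/
def swapSecond (d : ℕ) : Equiv.Perm (Fin d × Fin d × Fin d) where
  toFun x := (x.2.2, x.2.1, x.1)
  invFun x := (x.2.2, x.2.1, x.1)
  left_inv _ := rfl
  right_inv _ := rfl

/-- The gate teleportation circuit: the black box acts on one half of a maximally entangled pair,
and the input state and that half are then projected onto the maximally entangled state. -/
noncomputable def teleportCircuit (hd : 0 < d) : QueryCircuit d 1 (Fin d × Fin d) where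
  auxState := ketbra (maxEntangled d)
  auxState_posSemidef := Matrix.posSemidef_vecMulVec_self_star _
  auxState_trace := by
    rw [ketbra, Matrix.trace_vecMulVec, star_maxEntangled, maxEntangled_dotProduct hd]
  gate := ![(swapFirst d).permMatrix ℂ, (swapSecond d).permMatrix ℂ]
  gate_unitary j := by
    fin_cases j
    · exact permMatrix_mem_unitaryGroup _
    · exact permMatrix_mem_unitaryGroup _
  success := ketbra (maxEntangled d)
  success_isHermitian := (Matrix.posSemidef_vecMulVec_self_star _).isHermitian
  success_idem := by
    rw [ketbra, Matrix.vecMulVec_mul_vecMulVec, star_maxEntangled, maxEntangled_dotProduct hd,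
      one_smul]

theorem ketbra_kronecker_ketbra {m n : Type*} (x : m → ℂ) (y : n → ℂ) :
    ketbra x ⊗ₖ ketbra y = ketbra fun p : m × n => x p.1 * y p.2 := by
  ext ⟨i, a⟩ ⟨j, b⟩
  simp only [Matrix.kronecker_apply, ketbra, Matrix.vecMulVec_apply, Pi.star_apply, star_mul']
  ring

/-- After both swaps the auxiliary systems hold `ψ` and the half that met `U`, and the main system
holds the untouched half. Setting `a = b` and summing produces `Uᵀψ`. -/
theorem teleportCircuit_totalOp_mulVec (hd : 0 < d) (U : SUGroup d) (ψ : Fin d → ℂ)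
    (i a b : Fin d) :
    ((teleportCircuit hd).totalOp U).mulVec (fun p => ψ p.1 * maxEntangled d p.2) (i, a, b) =
      ψ a * U.1 b i * ((√(d : ℝ))⁻¹ : ℝ) := by
  have h : (teleportCircuit hd).totalOp U = (swapSecond d).permMatrix ℂ *
      (U.1 ⊗ₖ (1 : Matrix (Fin d × Fin d) (Fin d × Fin d) ℂ)) * (swapFirst d).permMatrix ℂ := rfl
  rw [h, ← Matrix.mulVec_mulVec, ← Matrix.mulVec_mulVec, Matrix.permMatrix_mulVec,
    Matrix.permMatrix_mulVec]
  simp only [Function.comp_apply, swapFirst, swapSecond, Equiv.coe_fn_mk, Matrix.mulVec, dotProduct,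
    Fintype.sum_prod_type, Matrix.kronecker_apply, maxEntangled, Matrix.one_apply, Prod.mk.injEq]
  simp [ite_and]
  ring

theorem teleportCircuit_implements (hd : 0 < d) (U : SUGroup d) :
    (teleportCircuit hd).Implements U U.1.transpose (1 / (d : ℝ) ^ 2) := by
  intro ψ _
  have hvec : ((1 : Matrix (Fin d) (Fin d) ℂ) ⊗ₖ (teleportCircuit hd).success).mulVec
      (((teleportCircuit hd).totalOp U).mulVec (fun p => ψ p.1 * maxEntangled d p.2)) =
      fun p => ((d : ℂ)⁻¹ * U.1.transpose.mulVec ψ p.1) * maxEntangled d p.2 := by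
    funext ⟨i, a, b⟩
    have hs : (teleportCircuit hd).success = ketbra (maxEntangled d) := rfl
    rw [Matrix.mulVec, dotProduct, Fintype.sum_prod_type]
    simp only [Fintype.sum_prod_type, teleportCircuit_totalOp_mulVec, hs, Matrix.kronecker_apply,
      ketbra, Matrix.vecMulVec_apply, star_maxEntangled, Matrix.one_apply, ite_mul, one_mul,
      zero_mul]
    simp only [Finset.sum_const_zero, Finset.sum_ite_irrel, Finset.sum_ite_eq, Finset.mem_univ,
      if_true]
    have hin : ∀ x : Fin d, ∑ y, maxEntangled d (a, b) * maxEntangled d (x, y) *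
        (ψ x * U.1 y i * ((√(d : ℝ))⁻¹ : ℝ)) =
        (d : ℂ)⁻¹ * (U.1 x i * ψ x) * maxEntangled d (a, b) := fun x => by
      rw [Finset.sum_eq_single x (fun y _ hy => by simp [maxEntangled, hy.symm]) (by simp),
        ← ofReal_inv_sqrt_mul_self]
      have : maxEntangled d (x, x) = ((√(d : ℝ))⁻¹ : ℝ) := if_pos rfl
      rw [this]
      ring
    simp only [hin, Matrix.mulVec, dotProduct, Matrix.transpose_apply, Finset.mul_sum,
      Finset.sum_mul]
  have haux : (teleportCircuit hd).auxState = ketbra (maxEntangled d) := rfl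
  rw [QueryCircuit.successOutput, haux, ketbra_kronecker_ketbra, mul_ketbra_mul_conjTranspose,
    mul_ketbra_mul_conjTranspose, hvec,
    ← ketbra_kronecker_ketbra (fun i => (d : ℂ)⁻¹ * U.1.transpose.mulVec ψ i) (maxEntangled d)]
  ext i j
  have htr : ∑ a, ketbra (maxEntangled d) a a = 1 := (teleportCircuit hd).auxState_trace
  simp only [partialTraceAux, Matrix.of_apply, Matrix.kronecker_apply, ← Finset.mul_sum, htr,
    mul_one, Matrix.smul_apply]
  simp only [ketbra, Matrix.vecMulVec_apply, Pi.star_apply, star_mul', smul_eq_mul]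
  simp
  ring

end Teleportation

/-! ### The upper bound on the success probability. -/

section UpperBound

variable {d : ℕ} {A : Type*} [Fintype A]

/-- The transpose of `Eₘₙ` pairs to `1` with `Eₘₙ` for all `d²` index pairs; this is the source of
the `d²` in the bound. -/
theorem crossTrace_transpose_kronecker (K : Matrix A A ℂ) :
    crossTrace (fun X : Matrix (Fin d) (Fin d) ℂ => X.transpose ⊗ₖ K) = (d : ℂ) ^ 2 * K.trace := by
  simp [crossTrace, Matrix.trace, pow_two, mul_assoc]

theorem crossTrace_one_kronecker (g : Matrix (Fin d) (Fin d) ℂ →ₗ[ℂ] Matrix A A ℂ) :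
    crossTrace (fun X : Matrix (Fin d) (Fin d) ℂ => (1 : Matrix (Fin d) (Fin d) ℂ) ⊗ₖ g X) =
      (g 1).trace := by
  have h : (1 : Matrix (Fin d) (Fin d) ℂ) = ∑ m, Matrix.single m m 1 := by
    ext i j
    simp [Matrix.sum_apply, Matrix.single_apply, Matrix.one_apply, ite_and]
  have hg : (g 1).trace = ∑ m, (g (Matrix.single m m 1)).trace := by
    rw [h, map_sum, Matrix.trace_sum]
  rw [hg, crossTrace]
  refine Finset.sum_congr rfl fun m _ => ?_
  rw [Finset.sum_eq_single m (fun n _ hn => by simp [Matrix.one_apply_ne hn]) (by simp)]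
  simp [Matrix.trace]

variable [DecidableEq A]

open scoped MatrixOrder Matrix.Norms.L2Operator in
theorem Matrix.PosSemidef.exists_eq_mul_conjTranspose {M : Matrix A A ℂ} (hM : M.PosSemidef) :
    ∃ S : Matrix A A ℂ, M = S * S.conjTranspose := by
  obtain ⟨B, hB⟩ := CStarAlgebra.nonneg_iff_eq_star_mul_self.mp hM.nonneg
  refine ⟨star B, ?_⟩
  rw [hB, ← Matrix.star_eq_conjTranspose, star_star]

theorem eq_of_unitary_kronecker_eq (hd : 0 < d) {W : Matrix (Fin d) (Fin d) ℂ}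
    (hW : W ∈ Matrix.unitaryGroup (Fin d) ℂ) {v w : Matrix A A ℂ} (h : W ⊗ₖ v = W ⊗ₖ w) :
    v = w := by
  have h₁ := congrArg (fun T => (star W ⊗ₖ (1 : Matrix A A ℂ)) * T) h
  simp only [← Matrix.mul_kronecker_mul, Matrix.mem_unitaryGroup_iff'.mp hW, Matrix.one_mul] at h₁
  ext a b
  simpa using congrFun (congrFun h₁ (⟨0, hd⟩, a)) (⟨0, hd⟩, b)

theorem transpose_mem_unitaryGroup {U : Matrix (Fin d) (Fin d) ℂ}
    (hU : U ∈ Matrix.unitaryGroup (Fin d) ℂ) : U.transpose ∈ Matrix.unitaryGroup (Fin d) ℂ := by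
  rw [Matrix.mem_unitaryGroup_iff]
  exact transpose_mul_map_star hU

/-- Contraction of the first-order relation: `(d² - 1 + N) ‖v₀‖² ≤ N d ‖v₀‖` in Frobenius norm. -/
theorem frobSq_bound (hd : 0 < d) {N : ℕ}
    {V : Fin (N + 1) → Matrix (Fin d × A) (Fin d × A) ℂ}
    (hV : ∀ j, V j ∈ Matrix.unitaryGroup (Fin d × A) ℂ) {P S : Matrix A A ℂ}
    (hP : P.IsHermitian) (hPP : P * P = P) (hS : frobSq S = 1) {U₀ : SUGroup d} {v₀ : Matrix A A ℂ}
    (h₀ : ((1 : Matrix (Fin d) (Fin d) ℂ) ⊗ₖ P) * interleave U₀.1 V *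
      ((1 : Matrix (Fin d) (Fin d) ℂ) ⊗ₖ S) = U₀.1.transpose ⊗ₖ v₀)
    (h : ∀ᶠ U : SUGroup d in 𝓝 U₀, ∃ v : Matrix A A ℂ,
      ((1 : Matrix (Fin d) (Fin d) ℂ) ⊗ₖ P) * interleave U.1 V *
        ((1 : Matrix (Fin d) (Fin d) ℂ) ⊗ₖ S) = U.1.transpose ⊗ₖ v) :
    ((d : ℝ) ^ 2 - 1 + N) * frobSq v₀ ≤ N * d * √(frobSq v₀) := by
  have hU₀ : U₀.1 ∈ Matrix.unitaryGroup (Fin d) ℂ :=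
    Matrix.specialUnitaryGroup_le_unitaryGroup U₀.2
  have hU₀t := transpose_mem_unitaryGroup hU₀
  let i₀ : Fin d := ⟨0, hd⟩
  let R : Matrix (Fin d × A) (Fin d × A) ℂ := (star U₀.1).transpose ⊗ₖ S
  let D : Matrix (Fin d) (Fin d) ℂ →ₗ[ℂ] Matrix (Fin d × A) (Fin d × A) ℂ :=
    { toFun := fun X => ((1 : Matrix (Fin d) (Fin d) ℂ) ⊗ₖ P) *
        interleaveDeriv U₀.1 (U₀.1 * X) V * R - X.transpose ⊗ₖ v₀
      map_add' := fun X Y => by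
        rw [Matrix.mul_add, interleaveDeriv_add, Matrix.transpose_add, Matrix.add_kronecker,
          Matrix.mul_add, Matrix.add_mul]
        abel
      map_smul' := fun c X => by
        rw [Matrix.mul_smul, interleaveDeriv_smul, Matrix.transpose_smul, Matrix.smul_kronecker,
          Matrix.mul_smul, Matrix.smul_mul, ← smul_sub, RingHom.id_apply] }
  -- Euler's identity contributes `N`, and the subtracted `Xᵀ ⊗ v₀` at `X = 1` contributes `-1`.
  have hD1 : D 1 = (1 : Matrix (Fin d) (Fin d) ℂ) ⊗ₖ (((N : ℂ) - 1) • v₀) := by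
    have hR : R = ((1 : Matrix (Fin d) (Fin d) ℂ) ⊗ₖ S) *
        ((star U₀.1).transpose ⊗ₖ (1 : Matrix A A ℂ)) := by
      rw [← Matrix.mul_kronecker_mul, Matrix.one_mul, Matrix.mul_one]
    change ((1 : Matrix (Fin d) (Fin d) ℂ) ⊗ₖ P) * interleaveDeriv U₀.1 (U₀.1 * 1) V * R -
      (1 : Matrix (Fin d) (Fin d) ℂ).transpose ⊗ₖ v₀ = _
    rw [Matrix.mul_one, interleaveDeriv_self, Matrix.mul_smul, Matrix.smul_mul, hR,
      ← Matrix.mul_assoc, h₀, ← Matrix.mul_kronecker_mul, transpose_mul_map_star hU₀,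
      Matrix.mul_one, Matrix.transpose_one, Matrix.kronecker_smul, sub_smul, one_smul]
  have hzero : nonScalarPart A i₀ ∘ₗ D = 0 :=
    eq_zero_of_vanish_on_specialUnitary hd _
      (by rw [LinearMap.comp_apply, hD1, nonScalarPart_one_kronecker])
      fun X hX htr => nonScalarPart_interleaveDeriv h₀ h i₀ hX htr
  let g : Matrix (Fin d) (Fin d) ℂ →ₗ[ℂ] Matrix A A ℂ :=
    { toFun := fun X => v₀.conjTranspose * (D X).submatrix (Prod.mk i₀) (Prod.mk i₀)
      map_add' := fun X Y => by
        rw [map_add, Matrix.submatrix_add, ← Matrix.mul_add]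
        rfl
      map_smul' := fun c X => by
        rw [map_smul, Matrix.submatrix_smul, Pi.smul_apply, Pi.smul_apply, Matrix.mul_smul,
          RingHom.id_apply] }
  have hg1 : g 1 = ((N : ℂ) - 1) • (v₀.conjTranspose * v₀) := by
    change v₀.conjTranspose * (D 1).submatrix (Prod.mk i₀) (Prod.mk i₀) = _
    rw [hD1, ← Matrix.mul_smul]
    congr 1
    ext a b
    simp
  have htrace : (v₀.conjTranspose * v₀).trace = (frobSq v₀ : ℂ) := by
    rw [Matrix.trace_mul_comm, trace_mul_conjTranspose_eq_frobSq]
  have hsplit : (fun X => (((1 : Matrix (Fin d) (Fin d) ℂ) ⊗ₖ v₀.conjTranspose) *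
        ((1 : Matrix (Fin d) (Fin d) ℂ) ⊗ₖ P)) * interleaveDeriv U₀.1 (U₀.1 * X) V * R) =
      fun X : Matrix (Fin d) (Fin d) ℂ => X.transpose ⊗ₖ (v₀.conjTranspose * v₀) +
        (1 : Matrix (Fin d) (Fin d) ℂ) ⊗ₖ g X := by
    funext X
    have hX : D X = _ := eq_one_kronecker_of_nonScalarPart_eq_zero (LinearMap.congr_fun hzero X)
    have hX' : ((1 : Matrix (Fin d) (Fin d) ℂ) ⊗ₖ P) * interleaveDeriv U₀.1 (U₀.1 * X) V * R =
        X.transpose ⊗ₖ v₀ + D X := (add_sub_cancel _ _).symm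
    rw [Matrix.mul_assoc, Matrix.mul_assoc, ← Matrix.mul_assoc (1 ⊗ₖ P), hX', hX, Matrix.mul_add,
      ← Matrix.mul_kronecker_mul, ← Matrix.mul_kronecker_mul, Matrix.one_mul, Matrix.one_mul]
    rfl
  have hbound := norm_crossTrace_interleaveDeriv_le hU₀ hV
    (((1 : Matrix (Fin d) (Fin d) ℂ) ⊗ₖ v₀.conjTranspose) *
      ((1 : Matrix (Fin d) (Fin d) ℂ) ⊗ₖ P)) R
  -- The range of `v₀` lies in that of `P`, so the projection disappears from the left factor, whose
  -- squared norm is exactly `d‖v₀‖²`.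
  have hPv : P * v₀ = v₀ := by
    refine eq_of_unitary_kronecker_eq hd hU₀t ?_
    have h₁ : U₀.1.transpose ⊗ₖ (P * v₀) =
        ((1 : Matrix (Fin d) (Fin d) ℂ) ⊗ₖ P) * (U₀.1.transpose ⊗ₖ v₀) := by
      rw [← Matrix.mul_kronecker_mul, Matrix.one_mul]
    rw [h₁, ← h₀, ← Matrix.mul_assoc, ← Matrix.mul_assoc, ← Matrix.mul_kronecker_mul, hPP,
      Matrix.one_mul]
  have hvP : v₀.conjTranspose * P = v₀.conjTranspose := by
    rw [← hP.eq, ← Matrix.conjTranspose_mul, hPv]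
  have hR : frobSq R = d := by
    have hsU : (star U₀.1).transpose ∈ Matrix.unitaryGroup (Fin d) ℂ :=
      transpose_mem_unitaryGroup (Unitary.star_mem hU₀)
    rw [frobSq_kronecker, hS, mul_one, frobSq_unitary hsU, Fintype.card_fin]
  rw [hsplit, crossTrace_add, crossTrace_transpose_kronecker, crossTrace_one_kronecker, hg1,
    Matrix.trace_smul, htrace, ← Matrix.mul_kronecker_mul, Matrix.one_mul, hvP, frobSq_kronecker,
    frobSq_one, frobSq_conjTranspose, hR, Fintype.card_fin] at hbound
  have hcast : (d : ℂ) ^ 2 * (frobSq v₀ : ℂ) + ((N : ℂ) - 1) • (frobSq v₀ : ℂ) =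
      ((((d : ℝ) ^ 2 - 1 + N) * frobSq v₀ : ℝ) : ℂ) := by
    push_cast
    rw [smul_eq_mul]
    ring
  rw [hcast, Complex.norm_real] at hbound
  refine (le_abs_self _).trans (hbound.trans (le_of_eq ?_))
  rw [Real.sqrt_mul (Nat.cast_nonneg d), mul_right_comm (√(d : ℝ)),
    Real.mul_self_sqrt (Nat.cast_nonneg d), mul_assoc]

theorem QueryCircuit.transpose_probability_le (hd : 0 < d) {N : ℕ} (hN : 0 < N)
    (C : QueryCircuit d N A) (U₀ : SUGroup d) (p : SUGroup d → ℝ)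
    (h : ∀ᶠ U in 𝓝 U₀, C.Implements U U.1.transpose (p U)) :
    p U₀ ≤ ((d : ℝ) / (((d : ℝ) ^ 2 - 1) / (N : ℝ) + 1)) ^ 2 := by
  obtain ⟨S, hS⟩ := C.auxState_posSemidef.exists_eq_mul_conjTranspose
  have hS1 : frobSq S = 1 := by
    have h₁ := trace_mul_conjTranspose_eq_frobSq S
    rw [← hS, C.auxState_trace] at h₁
    exact_mod_cast h₁.symm
  have hunit : ∀ U : SUGroup d, U.1.transpose ∈ Matrix.unitaryGroup (Fin d) ℂ := fun U =>
    transpose_mem_unitaryGroup (Matrix.specialUnitaryGroup_le_unitaryGroup U.2)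
  obtain ⟨v₀, hv₀, hp⟩ := h.self_of_nhds.exists_eq_kronecker hd hS (hunit U₀)
  have hev : ∀ᶠ U : SUGroup d in 𝓝 U₀, ∃ v : Matrix A A ℂ,
      ((1 : Matrix (Fin d) (Fin d) ℂ) ⊗ₖ C.success) * interleave U.1 C.gate *
        ((1 : Matrix (Fin d) (Fin d) ℂ) ⊗ₖ S) = U.1.transpose ⊗ₖ v := by
    filter_upwards [h] with U hU
    obtain ⟨v, hv, -⟩ := hU.exists_eq_kronecker hd hS (hunit U)
    exact ⟨v, hv⟩
  have key := frobSq_bound hd C.gate_unitary C.success_isHermitian C.success_idem hS1 hv₀ hev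
  rw [hp] at key
  have hp0 : 0 ≤ p U₀ := hp ▸ frobSq_nonneg v₀
  have hd1 : (1 : ℝ) ≤ d := by exact_mod_cast hd
  have hN0 : (0 : ℝ) < N := by exact_mod_cast hN
  have hden : 0 < (d : ℝ) ^ 2 - 1 + N := by nlinarith
  have hrhs : (d : ℝ) / (((d : ℝ) ^ 2 - 1) / N + 1) = N * d / ((d : ℝ) ^ 2 - 1 + N) := by
    have : ((d : ℝ) ^ 2 - 1) / N + 1 = ((d : ℝ) ^ 2 - 1 + N) / N := by
      field_simp
    rw [this, div_div_eq_mul_div, mul_comm]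
  rw [hrhs]
  have hs : √(p U₀) ≤ N * d / ((d : ℝ) ^ 2 - 1 + N) := by
    -- One factor `√p` is cancelled from `key`, which requires `p ≠ 0`.
    rcases (Real.sqrt_nonneg (p U₀)).eq_or_lt with h0 | hpos
    · rw [← h0]
      positivity
    · rw [le_div_iff₀ hden]
      refine le_of_mul_le_mul_right ?_ hpos
      calc √(p U₀) * ((d : ℝ) ^ 2 - 1 + N) * √(p U₀)
          = ((d : ℝ) ^ 2 - 1 + N) * (√(p U₀) * √(p U₀)) := by ring
        _ = ((d : ℝ) ^ 2 - 1 + N) * p U₀ := by rw [Real.mul_self_sqrt hp0]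
        _ ≤ N * d * √(p U₀) := key
  rw [← Real.sq_sqrt hp0]
  exact pow_le_pow_left₀ (Real.sqrt_nonneg _) hs 2

end UpperBound

/-! ### The main theorem. -/

theorem mainTheorem5 (d : ℕ) (hd : 0 < d) :
    (∀ (N : ℕ), 0 < N → ∀ (A : Type*) [Fintype A] [DecidableEq A] (C : QueryCircuit d N A)
      (U₀ : SUGroup d) (p : SUGroup d → ℝ), SUDifferentiableAt p U₀ →
      (∀ᶠ U in 𝓝 U₀, C.Implements U U.1.transpose (p U)) →
      p U₀ ≤ ((d : ℝ) / (((d : ℝ) ^ 2 - 1) / (N : ℝ) + 1)) ^ 2) ∧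
    (∀ (A : Type*) [Fintype A] [DecidableEq A] (C : QueryCircuit d 1 A)
      (U₀ : SUGroup d) (p : SUGroup d → ℝ), SUDifferentiableAt p U₀ →
      (∀ᶠ U in 𝓝 U₀, C.Implements U U.1.transpose (p U)) →
      p U₀ ≤ 1 / (d : ℝ) ^ 2) ∧
    (∃ C : QueryCircuit d 1 (Fin d × Fin d),
      ∀ U : SUGroup d, C.Implements U U.1.transpose (1 / (d : ℝ) ^ 2)) := by
  refine ⟨fun N hN A _ _ C U₀ p _ h => C.transpose_probability_le hd hN U₀ p h,
    fun A _ _ C U₀ p _ h => ?_, teleportCircuit hd, teleportCircuit_implements hd⟩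
  have hd' : (d : ℝ) ≠ 0 := by exact_mod_cast hd.ne'
  refine (C.transpose_probability_le hd one_pos U₀ p h).trans (le_of_eq ?_)
  rw [Nat.cast_one, div_one, sub_add_cancel, pow_two (d : ℝ), div_mul_cancel_left₀ hd']
  ring
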